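/- Let $p$ be a prime. Define groups $G_n$, $n\ge 0$, by $G_0:=\mathbb{Q}_p$ (the additive group) and $$G_{n+1}:=G_n *_{p^n\mathbb{Z}_p}\mathbb{Q}_p ,$$ the free product of $G_n$ and $\mathbb{Q}_p$ with amalgamated subgroup $p^n\mathbb{Z}_p$. Here $p^n\mathbb{Z}_p$ is regarded as a subgroup of $G_n$ through the first factor $\mathbb{Q}_p=G_0\subseteq G_n$ (on $p^n\mathbb{Z}_p$ the embeddings of all the factors $\mathbb{Q}_p$ of $G_n$ coincide). Thus $G_{n+1}=\mathbb{Q}_p*_{\mathbb{Z}_p}\mathbb{Q}_p*_{p\mathbb{Z}_p}\cdots*_{p^n\mathbb{Z}_p}\mathbb{Q}_p$, and $G_0\subseteq G_1\subseteq G_2\subseteq\cdots$ by the canonical embeddings. Let $G:=\bigcup_{n\ge 0}G_n$ be the ascending union (direct limit). **Theorem.** The group $G$ can be given the structure of a ($\mathbb{Q}_p$-analytic, Hausdorff) $1$-dimensional $p$-adic Lie group such that the following hold. (a) $\mathrm{Ad}(g)=\mathrm{id}$ for all $g\in G$, i.e. the kernel of the adjoint representation $\mathrm{Ad}\colon G\to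 \mathrm{GL}(L(G))$, where $L(G)=T_1G$ and $\mathrm{Ad}(g)=T_1(x\mapsto gxg^{-1})$, is all of $G$. (b) $G$ has no non-trivial abelian subnormal subgroup. (c) $G$ has a discrete normal subgroup $K$ such that $G/K\cong\mathbb{Q}_p$ as $p$-adic Lie groups (that is, there is an isomorphism of topological groups $G/K\to\mathbb{Q}_p$ whose composition with the quotient map $G\to G/K$ is a local analytic diffeomorphism), and $K=\ker\psi$ for some analytic homomorphism $\psi\colon G\to\mathrm{GL}_2(\mathbb{Q}_p)$. (d) The commutator subgroup $G'$ is discrete. Consequently, $\ker(\mathrm{Ad})$ has no abelian open normal subgroup. This refutes the assertion that, for each $p$-adic Lie group, the kernel of the adjoint representation has an abelian open normal subgroup. -/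

import Mathlib

open scoped Manifold ContDiff

namespace AmalgamLie

/-! ### The free product of two groups with an amalgamated subgroup -/

section Amalgam

variable {A B C : Type} [Group A] [Group B] [Group C]

/-- The family consisting of the two groups `A` (index `false`) and `C` (index `true`). -/
def Factor (A C : Type) : Bool → Type
  | false => A
  | true => C

instance (i : Bool) : Group (Factor A C i) :=
  match i with
  | false => inferInstanceAs (Group A)
  | true => inferInstanceAs (Group C)

/-- The two embeddings of the group `B` to be amalgamated. -/
def factorMap (α : B →* A) (γ : B →* C) : ∀ i, B →* Factor A C i
  | false => α
  | true => γ

/-- The amalgamated product `A *_B C`, where `B` is regarded as a subgroup of `A` through `α` and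
as a subgroup of `C` through `γ`. -/
abbrev Amalgam (α : B →* A) (γ : B →* C) : Type :=
  Monoid.PushoutI (factorMap α γ)

/-- The canonical homomorphism `A → A *_B C`. -/
def Amalgam.inl (α : B →* A) (γ : B →* C) : A →* Amalgam α γ :=
  Monoid.PushoutI.of (φ := factorMap α γ) false

/-- The canonical homomorphism `C → A *_B C`. -/
def Amalgam.inr (α : B →* A) (γ : B →* C) : C →* Amalgam α γ :=
  Monoid.PushoutI.of (φ := factorMap α γ) true

theorem Amalgam.inl_injective {α : B →* A} {γ : B →* C} (hα : Function.Injective α)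
    (hγ : Function.Injective γ) : Function.Injective (Amalgam.inl α γ) :=
  Monoid.PushoutI.of_injective (φ := factorMap α γ)
    (fun i => match i with
      | false => hα
      | true => hγ) false

end Amalgam

/-! ### The group `G` -/

section TheGroup

variable (p : ℕ) [Fact p.Prime]

/-- The subgroup `pⁿ ℤ_p` of `ℚ_p`; the additive group `ℚ_p` is written multiplicatively. -/
noncomputable def powSubgroup (n : ℕ) : Subgroup (Multiplicative ℚ_[p]) :=
  AddSubgroup.toSubgroup
    ((AddMonoidHom.mulLeft ((p : ℚ_[p]) ^ n)).comp
      (PadicInt.Coe.ringHom (p := p)).toAddMonoidHom).range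

theorem mem_powSubgroup (n : ℕ) (x : Multiplicative ℚ_[p]) :
    x ∈ powSubgroup p n ↔ ∃ z : ℤ_[p], (p : ℚ_[p]) ^ n * (z : ℚ_[p]) = x.toAdd :=
  Iff.rfl

/-- A group containing a copy of `ℚ_p`. -/
structure Stage where
  carrier : Type
  [group : Group carrier]
  incl : Multiplicative ℚ_[p] →* carrier
  incl_injective : Function.Injective incl

attribute [instance] Stage.group

variable {p} in
/-- The embedding of `pⁿ ℤ_p` into a group containing `ℚ_p`. -/
noncomputable def Stage.sub (S : Stage p) (n : ℕ) : powSubgroup p n →* S.carrier :=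
  S.incl.comp (powSubgroup p n).subtype

variable {p} in
theorem Stage.sub_injective (S : Stage p) (n : ℕ) : Function.Injective (S.sub n) :=
  S.incl_injective.comp Subtype.val_injective

variable {p} in
/-- The amalgamated product `S *_{pⁿ ℤ_p} ℚ_p`. -/
noncomputable def Stage.next (S : Stage p) (n : ℕ) : Stage p where
  carrier := Amalgam (S.sub n) (powSubgroup p n).subtype
  incl := (Amalgam.inl (S.sub n) (powSubgroup p n).subtype).comp S.incl
  incl_injective :=
    (Amalgam.inl_injective (S.sub_injective n) Subtype.val_injective).comp S.incl_injective

/-- The groups `G₀ = ℚ_p` and `Gₙ₊₁ = Gₙ *_{pⁿ ℤ_p} ℚ_p`, that is,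
`Gₙ₊₁ = ℚ_p *_{ℤ_p} ℚ_p *_{p ℤ_p} ⋯ *_{pⁿ ℤ_p} ℚ_p`. Each `Gₙ` is given along with the embedding
of the first factor `ℚ_p`; on the subgroup `pⁿ ℤ_p` amalgamated next, the embeddings of all the
factors of `Gₙ` coincide (for `1 ≤ n` even on `pⁿ⁻¹ ℤ_p`). -/
noncomputable def stage : ℕ → Stage p
  | 0 => ⟨Multiplicative ℚ_[p], MonoidHom.id _, Function.injective_id⟩
  | n + 1 => (stage n).next n

/-- The iterated amalgamated product `Gₙ`. -/
abbrev Gn (n : ℕ) : Type := (stage p n).carrier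

/-- The canonical embedding `Gₙ → Gₙ₊₁ = Gₙ *_{pⁿ ℤ_p} ℚ_p`. -/
noncomputable def step (n : ℕ) : Gn p n →* Gn p (n + 1) :=
  Amalgam.inl ((stage p n).sub n) (powSubgroup p n).subtype

/-- The embedding of the last factor `ℚ_p` into `Gₙ₊₁ = Gₙ *_{pⁿ ℤ_p} ℚ_p`. -/
noncomputable def lastFactor (n : ℕ) : Multiplicative ℚ_[p] →* Gn p (n + 1) :=
  Amalgam.inr ((stage p n).sub n) (powSubgroup p n).subtype

theorem step_injective (n : ℕ) : Function.Injective (step p n) :=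
  Amalgam.inl_injective ((stage p n).sub_injective n) Subtype.val_injective

/-- On `pⁿ ℤ_p`, the embedding of the last factor of `Gₙ₊₁` is that of the first one. -/
theorem lastFactor_eq_incl (n : ℕ) (x : Multiplicative ℚ_[p]) (hx : x ∈ powSubgroup p n) :
    lastFactor p n x = (stage p (n + 1)).incl x :=
  (Monoid.PushoutI.of_apply_eq_base
      (factorMap ((stage p n).sub n) (powSubgroup p n).subtype) true ⟨x, hx⟩).trans
    (Monoid.PushoutI.of_apply_eq_base
      (factorMap ((stage p n).sub n) (powSubgroup p n).subtype) false ⟨x, hx⟩).symm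

/-- The composite embedding `Gₘ → Gₘ₊₁ → ⋯ → Gₙ`, for `m ≤ n`. -/
noncomputable def trans (m n : ℕ) (h : m ≤ n) : Gn p m →* Gn p n :=
  Nat.leRecOn h (fun {k} g => (step p k).comp g) (MonoidHom.id (Gn p m))

theorem trans_self (m : ℕ) : trans p m m le_rfl = MonoidHom.id _ :=
  Nat.leRecOn_self _

theorem trans_succ (m n : ℕ) (h : m ≤ n) :
    trans p m (n + 1) (h.trans n.le_succ) = (step p n).comp (trans p m n h) :=
  Nat.leRecOn_succ h _

theorem trans_injective (m n : ℕ) (h : m ≤ n) : Function.Injective (trans p m n h) := by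
  induction n, h using Nat.le_induction with
  | base => rw [trans_self]; exact Function.injective_id
  | succ n h ih => rw [trans_succ p m n h]; exact (step_injective p n).comp ih

instance : DirectedSystem (Gn p) (fun m n h => (trans p m n h : Gn p m → Gn p n)) where
  map_self m x := by rw [trans_self]; rfl
  map_map {n m k} hkm hmn x := by
    induction n, hmn using Nat.le_induction with
    | base => rw [trans_self]; rfl
    | succ n hmn ih =>
      rw [trans_succ p m n hmn, trans_succ p k n (hkm.trans hmn)]
      exact congrArg (step p n) ih

/-- The ascending union `G = ⋃ₙ Gₙ`, the direct limit of `G₀ ⊆ G₁ ⊆ G₂ ⊆ ⋯` along the canonical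
embeddings. -/
abbrev G : Type := DirectLimit (Gn p) (trans p)

end TheGroup

/-! ### The adjoint representation of a Lie group -/

section Adjoint

variable {𝕜 : Type*} [NontriviallyNormedField 𝕜] {E : Type*} [NormedAddCommGroup E]
  [NormedSpace 𝕜 E] {H : Type*} [TopologicalSpace H] (I : ModelWithCorners 𝕜 E H)
  (L : Type*) [TopologicalSpace L] [ChartedSpace H L] [Group L]

/-- The derivative at `1` of the conjugation `x ↦ g x g⁻¹`, a linear endomorphism of the Lie
algebra `T₁ L` (note that `g 1 g⁻¹ = 1`). -/
noncomputable def adEnd (g : L) : GroupLieAlgebra I L →ₗ[𝕜] GroupLieAlgebra I L where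
  toFun v := (mfderiv I I (fun x : L => g * x * g⁻¹) 1 v : E)
  map_add' v w := (mfderiv I I (fun x : L => g * x * g⁻¹) 1).map_add v w
  map_smul' c v := (mfderiv I I (fun x : L => g * x * g⁻¹) 1).map_smul c v

theorem adEnd_one : adEnd I L 1 = 1 := by
  have h : (fun x : L => 1 * x * 1⁻¹) = id := by ext x; simp
  apply LinearMap.ext
  intro v
  change mfderiv I I (fun x : L => 1 * x * 1⁻¹) 1 v = v
  rw [h, mfderiv_id]
  rfl

variable [LieGroup I ω L]

theorem mdifferentiableAt_conj (g y : L) :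
    MDifferentiableAt I I (fun x : L => g * x * g⁻¹) y :=
  ((contMDiff_mul_right (I := I) (n := ω) (a := g⁻¹)).comp
    (contMDiff_mul_left (I := I) (n := ω) (a := g))).mdifferentiable (by simp) y

theorem adEnd_mul (g h : L) : adEnd I L (g * h) = adEnd I L g * adEnd I L h := by
  have e : (fun x : L => g * h * x * (g * h)⁻¹) =
      (fun x : L => g * x * g⁻¹) ∘ (fun x : L => h * x * h⁻¹) := by
    ext x; simp [mul_assoc]
  have e1 : h * 1 * h⁻¹ = (1 : L) := by simp
  have key := mfderiv_comp (I := I) (I' := I) (I'' := I) (1 : L)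
    (mdifferentiableAt_conj I L g (h * 1 * h⁻¹)) (mdifferentiableAt_conj I L h 1)
  rw [← e, e1] at key
  apply LinearMap.ext
  intro v
  exact congrArg (fun D : E →L[𝕜] E => D v) key

/-- The adjoint representation `Ad : L → GL(T₁ L)`. -/
noncomputable def Ad : L →* LinearMap.GeneralLinearGroup 𝕜 (GroupLieAlgebra I L) :=
  MonoidHom.toHomUnits
    { toFun := adEnd I L
      map_one' := adEnd_one I L
      map_mul' := adEnd_mul I L }

theorem coe_Ad (g : L) : (Ad I L g : GroupLieAlgebra I L →ₗ[𝕜] GroupLieAlgebra I L) =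
    adEnd I L g := rfl

end Adjoint

end AmalgamLie

/-!
The retraction `φ : G → ℚ_p` that is the identity on every factor `ℚ_p` splits the embedding `σ` of
the first factor. Each element of `Gₙ` is a product of elements of the factors, which are abelian
and share the subgroup `pⁿ ℤ_p`, so it commutes with `σ (pⁿ ℤ_p)` (`commute_incl_of_mem`). Such a
locally central splitting turns any group `Γ` into a Lie group: as a set, `Γ` is the product
of `ker φ` and `σ ℚ_p`, and it is given the topology of the product of the discrete set `ker φ` and
`ℚ_p`, with the restrictions of `φ` to the cosets of `σ ℚ_p` as charts
(`LocallyCentralSplitting.Space`). In these charts `φ` is the identity, so a continuous map into `Γ`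
is analytic once its composite with `φ` is, and only the continuity of the group operations needs
an argument; it comes from local centrality. Conjugations are the identity near `1`, whence `Ad` is
trivial; the kernel `K` of `φ` is discrete, and it is the kernel of `φ` followed by the embedding of
`ℚ_p` as the unitriangular matrices; and `G' ⊆ K` since `ℚ_p` is abelian.

An element `x` of an abelian subnormal subgroup is a bounded left Engel element: some iterated
commutator `[…[[g, x], x], …, x]`, of a length that does not depend on `g`, is trivial for all `g`
(`exists_iterate_commutator_mem`). But `G` has no such `x ≠ 1`. As `⋂ₙ pⁿ ℤ_p` is trivial, `x` lies
in some `G_N` outside `p^N ℤ_p`, and for `t` in the new factor of `G_N *_{p^N ℤ_p} ℚ_p`, outside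
`p^N ℤ_p`, the iterated commutators of `t` with `x` are products of nonempty reduced words
(`iterate_commutator_ne_one`), hence nontrivial by the normal form theorem for amalgamated products.
-/

namespace AmalgamLie

open scoped commutatorElement

/-! ### Iterated commutators and abelian subnormal subgroups -/

section Engel

variable {Γ : Type*} [Group Γ]

/-- If `S` is subnormal of defect at most `m` and `x ∈ S`, each iterated commutator
`[…[[g, x], x], …, x]` of length `m` lies in `S`: every bracket descends one step in a subnormal
series, since `x` belongs to all its members. -/
theorem exists_iterate_commutator_mem {S : Subgroup Γ} (hS : S.IsSubnormal) :
    ∃ m : ℕ, ∀ x ∈ S, ∀ g : Γ, (fun g => ⁅g, x⁆)^[m] g ∈ S := by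
  induction hS with
  | top => exact ⟨0, fun _ _ _ => Subgroup.mem_top _⟩
  | step H K hle _ hN ih =>
    obtain ⟨m, hm⟩ := ih
    refine ⟨m + 1, fun x hx g => ?_⟩
    rw [Function.iterate_succ_apply']
    have hg := hm x (hle hx) g
    set y := (fun g => ⁅g, x⁆)^[m] g
    have hconj : y * x * y⁻¹ ∈ H := hN.conj_mem ⟨x, hle hx⟩ hx ⟨y, hg⟩
    exact H.mul_mem hconj (H.inv_mem hx)

/-- A group none of whose nontrivial elements is a bounded left Engel element has no nontrivial
abelian subnormal subgroup. -/
theorem eq_bot_of_isSubnormal_of_commute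
    (hΓ : ∀ x : Γ, x ≠ 1 → ∃ g : Γ, ∀ m : ℕ, (fun g => ⁅g, x⁆)^[m] g ≠ 1)
    {S : Subgroup Γ} (hS : S.IsSubnormal) (hc : ∀ x ∈ S, ∀ y ∈ S, x * y = y * x) : S = ⊥ := by
  obtain ⟨m, hm⟩ := exists_iterate_commutator_mem hS
  refine (Subgroup.eq_bot_iff_forall S).2 fun x hx => ?_
  by_contra hx1
  obtain ⟨g, hg⟩ := hΓ x hx1
  apply hg (m + 1)
  rw [Function.iterate_succ_apply']
  exact commutatorElement_eq_one_iff_mul_comm.2 (hc _ (hm x hx g) x hx)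

theorem map_iterate_commutator {Γ' : Type*} [Group Γ'] (f : Γ →* Γ') (x g : Γ) (m : ℕ) :
    f ((fun g => ⁅g, x⁆)^[m] g) = (fun g => ⁅g, f x⁆)^[m] (f g) := by
  induction m with
  | zero => rfl
  | succ m ih =>
    rw [Function.iterate_succ_apply', Function.iterate_succ_apply', ← ih]
    exact map_commutatorElement f _ _

end Engel

/-! ### Reduced words in an amalgamated product -/

section Words

open Monoid Monoid.CoprodI

variable {ι : Type*} {M : ι → Type*} [∀ i, Group (M i)] {B : Type*} [Group B] (φ : ∀ i, B →* M i)

/-- A nonempty word is reduced if none of its letters lies in the amalgamated subgroup. -/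
def NeReduced {i j : ι} (w : NeWord M i j) : Prop :=
  PushoutI.Reduced φ w.toWord

variable {φ}

theorem neReduced_singleton {i : ι} {x : M i} (hx : x ∉ (φ i).range) (h1 : x ≠ 1) :
    NeReduced φ (NeWord.singleton x h1) := by
  intro g hg
  obtain rfl : g = ⟨i, x⟩ := List.mem_singleton.1 hg
  exact hx

theorem NeReduced.append {i j k l : ι} {w₁ : NeWord M i j} {w₂ : NeWord M k l}
    (h₁ : NeReduced φ w₁) (h₂ : NeReduced φ w₂) (hne : j ≠ k) :
    NeReduced φ (NeWord.append w₁ hne w₂) := fun g hg =>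
  (List.mem_append.1 hg).elim (h₁ g) (h₂ g)

theorem NeReduced.inv {i j : ι} {w : NeWord M i j} (h : NeReduced φ w) : NeReduced φ w.inv := by
  induction w with
  | singleton x h1 =>
    refine neReduced_singleton (fun hx => h ⟨_, x⟩ (List.mem_singleton_self _) ?_) _
    exact inv_mem_iff.1 hx
  | append w₁ hne w₂ ih₁ ih₂ =>
    exact (ih₂ fun g hg => h g (List.mem_append_right _ hg)).append
      (ih₁ fun g hg => h g (List.mem_append_left _ hg)) hne.symm

theorem NeReduced.ofCoprodI_prod_ne_one (hφ : ∀ i, Function.Injective (φ i)) {i j : ι}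
    {w : NeWord M i j} (h : NeReduced φ w) : PushoutI.ofCoprodI (φ := φ) w.prod ≠ 1 := by
  intro h1
  have := PushoutI.Reduced.eq_empty_of_mem_range hφ h
    (show PushoutI.ofCoprodI w.prod ∈ (PushoutI.base φ).range from h1 ▸ one_mem _)
  exact w.toList_ne_nil (congrArg Word.toList this)

/-- Let `x`, `t` be elements of two different factors of an amalgamated product, neither of them
in the amalgamated subgroup. Then no iterated commutator `[…[[t, x], x], …, x]` is trivial.
Every such commutator is of the form `w` or `w x⁻¹` with a reduced word `w` that starts and ends
with a letter of the factor of `t`; the next commutator is then `(w x w⁻¹) x⁻¹`, where again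
`w x w⁻¹` is reduced. -/
theorem iterate_commutator_ne_one (hφ : ∀ i, Function.Injective (φ i)) {i j : ι} (hij : i ≠ j)
    {x : M i} (hx : x ∉ (φ i).range) {t : M j} (ht : t ∉ (φ j).range) (m : ℕ) :
    (fun g => ⁅g, PushoutI.of (φ := φ) i x⁆)^[m] (PushoutI.of j t) ≠ 1 := by
  have hx1 : x ≠ 1 := fun h => hx (h ▸ one_mem _)
  have ht1 : t ≠ 1 := fun h => ht (h ▸ one_mem _)
  have hX := neReduced_singleton hx hx1
  have hXp : PushoutI.ofCoprodI (φ := φ) (NeWord.singleton x hx1).prod = PushoutI.of i x := by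
    simp
  have key : ∃ w : NeWord M j j, NeReduced φ w ∧
      ((fun g => ⁅g, PushoutI.of (φ := φ) i x⁆)^[m] (PushoutI.of j t) =
          PushoutI.ofCoprodI w.prod ∨
        (fun g => ⁅g, PushoutI.of (φ := φ) i x⁆)^[m] (PushoutI.of j t) =
          PushoutI.ofCoprodI w.prod * (PushoutI.of i x)⁻¹) := by
    induction m with
    | zero => exact ⟨_, neReduced_singleton ht ht1, Or.inl (by simp)⟩
    | succ m ih =>
      obtain ⟨w, hw, h⟩ := ih
      refine ⟨_, (hw.append hX hij.symm).append hw.inv hij, Or.inr ?_⟩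
      rw [Function.iterate_succ_apply', NeWord.append_prod, NeWord.append_prod, NeWord.inv_prod,
        map_mul, map_mul, map_inv, hXp]
      rcases h with h | h <;> rw [h, commutatorElement_def]
      group
  obtain ⟨w, hw, h | h⟩ := key <;> rw [h]
  · exact hw.ofCoprodI_prod_ne_one hφ
  · have := (hw.append hX.inv hij.symm).ofCoprodI_prod_ne_one hφ
    rwa [NeWord.append_prod, NeWord.inv_prod, map_mul, map_inv, hXp] at this

end Words

/-! ### The subgroups `pⁿ ℤ_p` of `ℚ_p` -/

section PowSubgroup

variable (p : ℕ) [hp : Fact p.Prime]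

theorem mem_powSubgroup_iff_norm_le (n : ℕ) (x : Multiplicative ℚ_[p]) :
    x ∈ powSubgroup p n ↔ ‖x.toAdd‖ ≤ ((p : ℝ) ^ n)⁻¹ := by
  have hp0 : (p : ℚ_[p]) ≠ 0 := Nat.cast_ne_zero.2 hp.out.ne_zero
  have hpos : (0 : ℝ) < (p : ℝ) ^ n := pow_pos (Nat.cast_pos.2 hp.out.pos) n
  rw [mem_powSubgroup]
  constructor
  · rintro ⟨z, hz⟩
    rw [← hz, norm_mul, norm_pow, Padic.norm_p, inv_pow]
    exact mul_le_of_le_one_right (inv_nonneg.2 hpos.le) z.2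
  · intro h
    refine ⟨⟨((p : ℚ_[p]) ^ n)⁻¹ * x.toAdd, ?_⟩, mul_inv_cancel_left₀ (pow_ne_zero n hp0) _⟩
    rw [norm_mul, norm_inv, norm_pow, Padic.norm_p, inv_pow, inv_inv]
    calc (p : ℝ) ^ n * ‖x.toAdd‖ ≤ (p : ℝ) ^ n * ((p : ℝ) ^ n)⁻¹ := by gcongr
      _ = 1 := mul_inv_cancel₀ hpos.ne'

theorem powSubgroup_antitone : Antitone (powSubgroup p) := by
  intro m n h x hx
  rw [mem_powSubgroup_iff_norm_le] at hx ⊢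
  refine hx.trans (inv_anti₀ (pow_pos (Nat.cast_pos.2 hp.out.pos) m) ?_)
  exact pow_le_pow_right₀ (Nat.one_le_cast.2 hp.out.one_le) h

theorem eventually_mem_powSubgroup (n : ℕ) :
    ∀ᶠ x in nhds (0 : ℚ_[p]), Multiplicative.ofAdd x ∈ powSubgroup p n := by
  have hpos : (0 : ℝ) < ((p : ℝ) ^ n)⁻¹ := inv_pos.2 (pow_pos (Nat.cast_pos.2 hp.out.pos) n)
  filter_upwards [Metric.closedBall_mem_nhds (0 : ℚ_[p]) hpos] with x hx
  rw [mem_powSubgroup_iff_norm_le]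
  simpa using hx

theorem exists_notMem_powSubgroup (n : ℕ) : ∃ t, t ∉ powSubgroup p n := by
  -- The element `p⁻¹` has norm `p > 1`, so it is not even in `ℤ_p`.
  refine ⟨Multiplicative.ofAdd (p : ℚ_[p])⁻¹, fun h => ?_⟩
  rw [mem_powSubgroup_iff_norm_le, toAdd_ofAdd, norm_inv, Padic.norm_p, inv_inv] at h
  have h1 : (1 : ℝ) < p := Nat.one_lt_cast.2 hp.out.one_lt
  have h2 : ((p : ℝ) ^ n)⁻¹ ≤ 1 := inv_le_one_of_one_le₀ (one_le_pow₀ h1.le)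
  linarith

theorem exists_le_notMem_powSubgroup {x : Multiplicative ℚ_[p]} (hx : x ≠ 1) (n : ℕ) :
    ∃ N, n ≤ N ∧ x ∉ powSubgroup p N := by
  have hx0 : 0 < ‖x.toAdd‖ := norm_pos_iff.2 hx
  have h1 : (p : ℝ)⁻¹ < 1 := inv_lt_one_of_one_lt₀ (Nat.one_lt_cast.2 hp.out.one_lt)
  obtain ⟨k, hk⟩ := exists_pow_lt_of_lt_one hx0 h1
  refine ⟨max n k, le_max_left _ _, fun h => ?_⟩
  have := (mem_powSubgroup_iff_norm_le p k x).1 (powSubgroup_antitone p (le_max_right n k) h)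
  rw [inv_pow] at hk
  exact absurd this hk.not_ge

end PowSubgroup

/-! ### The retraction onto `ℚ_p` and the local centrality of `ℚ_p` -/

section Limit

variable (p : ℕ) [Fact p.Prime]

variable {p} in
/-- A retraction of `S` onto `ℚ_p`, extended to `S *_{pⁿ ℤ_p} ℚ_p` by the identity of the second
factor. -/
noncomputable def Stage.nextProj (S : Stage p) (n : ℕ) (r : S.carrier →* Multiplicative ℚ_[p])
    (hr : ∀ x, r (S.incl x) = x) : (S.next n).carrier →* Multiplicative ℚ_[p] :=
  Monoid.PushoutI.lift (φ := factorMap (S.sub n) (powSubgroup p n).subtype)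
    (fun i => match i with
      | false => r
      | true => MonoidHom.id _)
    (powSubgroup p n).subtype
    (fun i => match i with
      | false => MonoidHom.ext fun x => hr x
      | true => rfl)

variable {p} in
theorem Stage.nextProj_inl (S : Stage p) (n : ℕ) (r : S.carrier →* Multiplicative ℚ_[p])
    (hr : ∀ x, r (S.incl x) = x) (a : S.carrier) :
    S.nextProj n r hr (Amalgam.inl (S.sub n) (powSubgroup p n).subtype a) = r a :=
  Monoid.PushoutI.lift_of (φ := factorMap (S.sub n) (powSubgroup p n).subtype) _ _ _
    (i := false) a

/-- The retraction `Gₙ → ℚ_p` that is the identity on each of the factors `ℚ_p`. -/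
noncomputable def stageProj :
    ∀ n, { r : Gn p n →* Multiplicative ℚ_[p] // ∀ x, r ((stage p n).incl x) = x }
  | 0 => ⟨MonoidHom.id _, fun _ => rfl⟩
  | n + 1 => ⟨(stage p n).nextProj n (stageProj n).1 (stageProj n).2, fun x =>
      ((stage p n).nextProj_inl n _ _ _).trans ((stageProj n).2 x)⟩

theorem stageProj_trans (m n : ℕ) (h : m ≤ n) (a : Gn p m) :
    (stageProj p n).1 (trans p m n h a) = (stageProj p m).1 a := by
  induction n, h using Nat.le_induction with
  | base => rw [trans_self]; rfl
  | succ n h ih =>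
    rw [trans_succ p m n h]
    exact ((stage p n).nextProj_inl n (stageProj p n).1 (stageProj p n).2 _).trans ih

theorem trans_incl (m n : ℕ) (h : m ≤ n) (x : Multiplicative ℚ_[p]) :
    trans p m n h ((stage p m).incl x) = (stage p n).incl x := by
  induction n, h using Nat.le_induction with
  | base => rw [trans_self]; rfl
  | succ n h ih =>
    rw [trans_succ p m n h]
    exact congrArg (step p n) ih

/-- The subgroup `pⁿ ℤ_p` is central in `Gₙ`: it lies in each of the factors, and these are
abelian. -/
theorem commute_incl_of_mem (n : ℕ) (a : Gn p n) (x : Multiplicative ℚ_[p])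
    (hx : x ∈ powSubgroup p n) : Commute a ((stage p n).incl x) := by
  induction n with
  | zero => exact Commute.all (S := Multiplicative ℚ_[p]) a x
  | succ n ih =>
    have hx' := powSubgroup_antitone p n.le_succ hx
    induction a using Monoid.PushoutI.induction_on with
    | of i g =>
      match i with
      | false => exact (ih g hx').map (step p n)
      | true =>
        rw [← lastFactor_eq_incl p n x hx']
        exact (Commute.all (S := Multiplicative ℚ_[p]) g x).map (lastFactor p n)
    | base b =>
      have h : step p n ((stage p n).sub n b) = Monoid.PushoutI.base _ b :=
        Monoid.PushoutI.of_apply_eq_base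
          (factorMap ((stage p n).sub n) (powSubgroup p n).subtype) false b
      rw [← h]
      exact (ih _ hx').map (step p n)
    | mul a b ha hb => exact ha.mul_left hb

/-- The canonical embedding `Gₙ → G`. -/
noncomputable def toG (n : ℕ) : Gn p n →* G p where
  toFun a := ⟦⟨n, a⟩⟧
  map_one' := (DirectLimit.one_def n).symm
  map_mul' a b := (DirectLimit.mul_def n a b).symm

theorem toG_injective (n : ℕ) : Function.Injective (toG p n) :=
  DirectLimit.mk_injective _ (trans_injective p) n

theorem toG_trans (m n : ℕ) (h : m ≤ n) (a : Gn p m) : toG p n (trans p m n h a) = toG p m a :=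
  DirectLimit.mk_apply m n a h

theorem exists_toG (g : G p) : ∃ n a, toG p n a = g := by
  obtain ⟨n, a, h⟩ := DirectLimit.exists_eq_mk _ g
  exact ⟨n, a, h.symm⟩

/-- The retraction `G → ℚ_p` that is the identity on each of the factors `ℚ_p`. -/
noncomputable def projG : G p →* Multiplicative ℚ_[p] where
  toFun := DirectLimit.lift (trans p) (fun n => (stageProj p n).1)
    fun m n h a => (stageProj_trans p m n h a).symm
  map_one' := DirectLimit.lift_one _ _
  map_mul' a b := DirectLimit.lift_mul _ _ a b

/-- No nontrivial element of `G` is a bounded left Engel element. -/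
theorem exists_iterate_commutator_ne_one (x : G p) (hx : x ≠ 1) :
    ∃ g : G p, ∀ m : ℕ, (fun g => ⁅g, x⁆)^[m] g ≠ 1 := by
  obtain ⟨n, a, rfl⟩ := exists_toG p x
  -- Since `⋂ₙ pⁿ ℤ_p` is trivial, `a` avoids the amalgamated subgroup at some later stage.
  obtain ⟨N, hN, ha⟩ : ∃ N, ∃ h : n ≤ N, trans p n N h a ∉ ((stage p N).sub N).range := by
    by_cases h1 : (stageProj p n).1 a = 1
    · refine ⟨n, le_rfl, ?_⟩
      rintro ⟨c, hc⟩
      have hc : (stage p n).incl c = a := by rw [trans_self] at hc; exact hc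
      rw [← hc, (stageProj p n).2] at h1
      rw [h1, map_one] at hc
      exact hx (by rw [← hc, map_one])
    · obtain ⟨N, hN, h⟩ := exists_le_notMem_powSubgroup p h1 n
      refine ⟨N, hN, ?_⟩
      rintro ⟨c, hc⟩
      have hc : (stage p N).incl c = trans p n N hN a := hc
      have := congrArg (stageProj p N).1 hc
      rw [(stageProj p N).2, stageProj_trans] at this
      exact h (this ▸ c.2)
  obtain ⟨t, ht⟩ := exists_notMem_powSubgroup p N
  refine ⟨toG p (N + 1) (lastFactor p N t), fun m hm => ?_⟩
  rw [← toG_trans p n (N + 1) (hN.trans N.le_succ), trans_succ p n N hN,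
    ← map_iterate_commutator, ← map_one (toG p (N + 1))] at hm
  refine iterate_commutator_ne_one
    (φ := factorMap ((stage p N).sub N) (powSubgroup p N).subtype)
    (fun i => match i with
      | false => (stage p N).sub_injective N
      | true => Subtype.val_injective)
    Bool.false_ne_true ha (j := true) (t := t) ?_ m (toG_injective p _ hm)
  rintro ⟨c, hc⟩
  exact ht (hc ▸ c.2)

end Limit

/-! ### Unitriangular matrices -/

/-- The additive group of a commutative ring as the group of upper unitriangular `2 × 2`
matrices. -/
def unitriangular (R : Type*) [CommRing R] :
    Multiplicative R →* Matrix.GeneralLinearGroup (Fin 2) R :=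
  MonoidHom.toHomUnits
    { toFun := fun x => !![1, x.toAdd; 0, 1]
      map_one' := Matrix.one_fin_two.symm
      map_mul' := fun x y => by simp [add_comm] }

theorem coe_unitriangular {R : Type*} [CommRing R] (x : Multiplicative R) :
    (unitriangular R x : Matrix (Fin 2) (Fin 2) R) = !![1, x.toAdd; 0, 1] := rfl

theorem unitriangular_injective (R : Type*) [CommRing R] :
    Function.Injective (unitriangular R) := fun x y h => by
  have := congrArg
    (fun M : Matrix.GeneralLinearGroup (Fin 2) R => (M : Matrix (Fin 2) (Fin 2) R) 0 1) h
  simpa [coe_unitriangular] using this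

/-! ### The Lie group attached to a locally central split extension -/

section LocallyCentral

open Filter Topology

theorem nhds_induced_bot {X Y : Type*} (f : X → Y) (x : X) :
    @nhds X (TopologicalSpace.induced f ⊥) x = comap f (pure (f x)) := by
  let : TopologicalSpace Y := ⊥
  have : DiscreteTopology Y := ⟨rfl⟩
  rw [nhds_induced, nhds_discrete]

/-- A retraction of a group `Γ` onto the additive group of a field `𝕜`, together with a section
that is locally central: each element of `Γ` commutes with the image of a neighbourhood of `0`. -/
structure LocallyCentralSplitting (𝕜 Γ : Type*) [NontriviallyNormedField 𝕜] [Group Γ] where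
  proj : Γ →* Multiplicative 𝕜
  sec : Multiplicative 𝕜 →* Γ
  proj_sec : ∀ x, proj (sec x) = x
  eventually_commute : ∀ g : Γ, ∀ᶠ x in 𝓝 (0 : 𝕜), Commute g (sec (Multiplicative.ofAdd x))

namespace LocallyCentralSplitting

variable {𝕜 Γ : Type*} [NontriviallyNormedField 𝕜] [Group Γ]

/-- The group `Γ`, as the carrier of the topology and the analytic structure defined by a locally
central splitting. -/
def Space (_ : LocallyCentralSplitting 𝕜 Γ) : Type _ := Γ

variable (s : LocallyCentralSplitting 𝕜 Γ)

instance : Group s.Space := inferInstanceAs (Group Γ)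

/-- The retraction, written additively. -/
def coord (g : s.Space) : 𝕜 := (s.proj g).toAdd

/-- The section, written additively. -/
def lift (x : 𝕜) : s.Space := s.sec (Multiplicative.ofAdd x)

/-- The component of `g` in the kernel of the retraction. -/
def kerPart (g : s.Space) : s.Space := g * (s.lift (s.coord g))⁻¹

@[simp] theorem coord_lift (x : 𝕜) : s.coord (s.lift x) = x := s.proj_sec _

@[simp] theorem coord_mul (g h : s.Space) : s.coord (g * h) = s.coord g + s.coord h :=
  congrArg Multiplicative.toAdd (map_mul s.proj g h)

@[simp] theorem coord_inv (g : s.Space) : s.coord g⁻¹ = -s.coord g :=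
  congrArg Multiplicative.toAdd (map_inv s.proj g)

@[simp] theorem coord_one : s.coord 1 = 0 :=
  congrArg Multiplicative.toAdd (map_one s.proj)

theorem lift_add (x y : 𝕜) : s.lift (x + y) = s.lift x * s.lift y :=
  map_mul s.sec (Multiplicative.ofAdd x) (Multiplicative.ofAdd y)

@[simp] theorem lift_zero : s.lift 0 = 1 := map_one s.sec

@[simp] theorem coord_kerPart (g : s.Space) : s.coord (s.kerPart g) = 0 := by simp [kerPart]

theorem kerPart_mul_lift (g : s.Space) : s.kerPart g * s.lift (s.coord g) = g := by
  simp [kerPart]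

theorem kerPart_eq_self {g : s.Space} (hg : s.coord g = 0) : s.kerPart g = g := by
  simp [kerPart, hg]

/-- The component in the kernel is constant on the cosets of the section. -/
theorem kerPart_mul_lift_right (g : s.Space) (x : 𝕜) :
    s.kerPart (g * s.lift x) = s.kerPart g := by
  simp [kerPart, lift_add, mul_assoc]

@[simp] theorem kerPart_lift (x : 𝕜) : s.kerPart (s.lift x) = 1 := by simp [kerPart]

/-- The topology of the product of the discrete kernel of the retraction and `𝕜`. -/
instance instTopologicalSpace : TopologicalSpace s.Space :=
  TopologicalSpace.induced s.kerPart ⊥ ⊓ TopologicalSpace.induced s.coord inferInstance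

theorem continuous_coord : Continuous s.coord :=
  continuous_iff_le_induced.2 inf_le_right

theorem isOpen_kerPart_eq (c : s.Space) : IsOpen {g | s.kerPart g = c} := by
  have h : IsOpen[TopologicalSpace.induced s.kerPart ⊥] {g | s.kerPart g = c} :=
    ⟨{c}, trivial, rfl⟩
  exact h.mono inf_le_left

theorem eventually_kerPart_eq (g : s.Space) : ∀ᶠ h in 𝓝 g, s.kerPart h = s.kerPart g :=
  (s.isOpen_kerPart_eq _).mem_nhds rfl

/-- Continuity into `s.Space` means that the component in the kernel is locally constant and that
the coordinate is continuous. -/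
theorem continuousAt_iff {X : Type*} [TopologicalSpace X] {f : X → s.Space} {x : X} :
    ContinuousAt f x ↔
      (∀ᶠ y in 𝓝 x, s.kerPart (f y) = s.kerPart (f x)) ∧ ContinuousAt (s.coord ∘ f) x := by
  refine ⟨fun h => ⟨h.eventually (s.eventually_kerPart_eq _),
    s.continuous_coord.continuousAt.comp h⟩, fun ⟨h₁, h₂⟩ => ?_⟩
  have hn : 𝓝 (f x) = comap s.kerPart (pure (s.kerPart (f x))) ⊓
      comap s.coord (𝓝 (s.coord (f x))) := by
    refine (nhds_inf (t₁ := .induced s.kerPart ⊥) (t₂ := .induced s.coord inferInstance)).trans ?_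
    rw [nhds_induced_bot, nhds_induced]
  rw [ContinuousAt, hn, tendsto_inf, tendsto_comap_iff, tendsto_comap_iff, tendsto_pure]
  exact ⟨h₁, h₂⟩

theorem continuous_lift : Continuous s.lift :=
  continuous_iff_continuousAt.2 fun _ => s.continuousAt_iff.2
    ⟨by simp, by simpa [Function.comp_def] using continuousAt_id' _⟩

instance instT2Space : T2Space s.Space := by
  refine t2_iff_nhds.2 fun {g h} hgh => ?_
  have := hgh
  have hk : s.kerPart g = s.kerPart h := by
    obtain ⟨y, hy₁, hy₂⟩ := (((s.eventually_kerPart_eq g).filter_mono inf_le_left).and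
      ((s.eventually_kerPart_eq h).filter_mono (inf_le_right (a := 𝓝 g)))).exists
    exact hy₁.symm.trans hy₂
  have hc : s.coord g = s.coord h :=
    tendsto_nhds_unique (f := s.coord) (l := 𝓝 g ⊓ 𝓝 h)
      (s.continuous_coord.continuousAt.mono_left inf_le_left)
      (s.continuous_coord.continuousAt.mono_left inf_le_right)
  rw [← s.kerPart_mul_lift g, ← s.kerPart_mul_lift h, hk, hc]

/-- The chart at `g`: the retraction restricted to the coset of the section through `g`. -/
def chart (g : s.Space) : OpenPartialHomeomorph s.Space 𝕜 where
  toFun := s.coord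
  invFun x := s.kerPart g * s.lift x
  source := {h | s.kerPart h = s.kerPart g}
  target := Set.univ
  map_source' _ _ := trivial
  map_target' x _ :=
    (s.kerPart_mul_lift_right _ _).trans (s.kerPart_eq_self (s.coord_kerPart g))
  left_inv' h hh := by
    rw [← show s.kerPart h = s.kerPart g from hh, kerPart_mul_lift]
  right_inv' x _ := by simp
  open_source := s.isOpen_kerPart_eq _
  open_target := isOpen_univ
  continuousOn_toFun := s.continuous_coord.continuousOn
  continuousOn_invFun := by
    refine Continuous.continuousOn (continuous_iff_continuousAt.2 fun x => ?_)
    exact s.continuousAt_iff.2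
      ⟨by simp [kerPart_mul_lift_right], by simpa [Function.comp_def] using continuousAt_id' _⟩

instance instChartedSpace : ChartedSpace 𝕜 s.Space where
  atlas := Set.range s.chart
  chartAt := s.chart
  mem_chart_source _ := rfl
  chart_mem_atlas g := ⟨g, rfl⟩

open scoped Manifold ContDiff

-- All charts are restrictions of one map, so the changes of charts are identities.
instance : IsManifold 𝓘(𝕜) ω s.Space := by
  refine isManifold_of_contDiffOn _ _ _ ?_
  rintro _ _ ⟨g, rfl⟩ ⟨h, rfl⟩
  refine contDiffOn_id.congr fun x _ => ?_
  change s.coord (s.kerPart g * s.lift x) = x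
  simp

theorem contMDiff_coord : ContMDiff 𝓘(𝕜) 𝓘(𝕜) ω s.coord := fun g =>
  contMDiffAt_extChartAt (I := 𝓘(𝕜)) (x := g)

/-- A continuous map into `s.Space` is analytic as soon as its composite with the retraction is. -/
theorem contMDiff_of_coord {E H M : Type*} [NormedAddCommGroup E] [NormedSpace 𝕜 E]
    [TopologicalSpace H] {I : ModelWithCorners 𝕜 E H} [TopologicalSpace M] [ChartedSpace H M]
    {f : M → s.Space} (hf : Continuous f) (h : ContMDiff I 𝓘(𝕜) ω (s.coord ∘ f)) :
    ContMDiff I 𝓘(𝕜) ω f := fun x =>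
  contMDiffAt_iff_target.2 ⟨hf.continuousAt, h x⟩

theorem eventually_commute_lift (g h : s.Space) :
    ∀ᶠ y in 𝓝 h, Commute g (s.lift (s.coord y - s.coord h)) := by
  have hc : Tendsto (fun y => s.coord y - s.coord h) (𝓝 h) (𝓝 0) := by
    have := s.continuous_coord.continuousAt.tendsto (x := h) |>.sub_const (s.coord h)
    rwa [sub_self] at this
  exact hc.eventually (s.eventually_commute g)

/-- Near `h`, each `y` is `h * lift u` with small `u`. -/
theorem eventually_eq_mul_lift (h : s.Space) :
    ∀ᶠ y in 𝓝 h, y = h * s.lift (s.coord y - s.coord h) := by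
  filter_upwards [s.eventually_kerPart_eq h] with y hy
  calc y = s.kerPart h * s.lift (s.coord y) := by rw [← hy, kerPart_mul_lift]
    _ = s.kerPart h * s.lift (s.coord h) * s.lift (s.coord y - s.coord h) := by
      rw [mul_assoc, ← lift_add, add_sub_cancel]
    _ = h * s.lift (s.coord y - s.coord h) := by rw [kerPart_mul_lift]

theorem continuous_mul' : Continuous fun q : s.Space × s.Space => q.1 * q.2 := by
  refine continuous_iff_continuousAt.2 fun ⟨g, h⟩ => s.continuousAt_iff.2 ⟨?_, ?_⟩
  · filter_upwards [continuousAt_fst.eventually (s.eventually_eq_mul_lift g),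
      continuousAt_fst.eventually (s.eventually_commute_lift h g),
      continuousAt_snd.eventually (s.eventually_eq_mul_lift h)] with q hq₁ hc hq₂
    have e : q.1 * q.2 = g * h *
        s.lift (s.coord q.1 - s.coord g + (s.coord q.2 - s.coord h)) := by
      rw [lift_add, hq₁, hq₂]
      simp only [coord_mul, coord_lift, add_sub_cancel_left] at hc ⊢
      calc _ = g * (s.lift (s.coord q.1 - s.coord g) * h) *
              s.lift (s.coord q.2 - s.coord h) := by simp only [mul_assoc]
        _ = _ := by rw [← hc.eq]; simp only [mul_assoc]
    rw [e, kerPart_mul_lift_right]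
  · have h₁ : (s.coord ∘ fun q : s.Space × s.Space => q.1 * q.2) =
        fun q => s.coord q.1 + s.coord q.2 := funext fun q => s.coord_mul _ _
    rw [h₁]
    exact ((s.continuous_coord.comp continuous_fst).add
      (s.continuous_coord.comp continuous_snd)).continuousAt

theorem continuous_inv' : Continuous fun g : s.Space => g⁻¹ := by
  refine continuous_iff_continuousAt.2 fun g => s.continuousAt_iff.2 ⟨?_, ?_⟩
  · filter_upwards [s.eventually_eq_mul_lift g, s.eventually_commute_lift g g] with y hy hc
    have e : y⁻¹ = g⁻¹ * s.lift (-(s.coord y - s.coord g)) := by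
      have hl : s.lift (-(s.coord y - s.coord g)) = (s.lift (s.coord y - s.coord g))⁻¹ :=
        map_inv s.sec _
      rw [hl, ← mul_inv_rev, ← hc.eq, ← hy]
    rw [e, kerPart_mul_lift_right]
  · have h₁ : (s.coord ∘ fun g : s.Space => g⁻¹) = fun g => -s.coord g :=
      funext fun g => s.coord_inv _
    rw [h₁]
    exact s.continuous_coord.neg.continuousAt

instance instLieGroup : LieGroup 𝓘(𝕜) ω s.Space where
  contMDiff_mul := by
    refine s.contMDiff_of_coord s.continuous_mul' ?_
    have h₁ : (s.coord ∘ fun q : s.Space × s.Space => q.1 * q.2) =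
        fun q => s.coord q.1 + s.coord q.2 := funext fun q => s.coord_mul _ _
    rw [h₁]
    exact (s.contMDiff_coord.comp contMDiff_fst).add (s.contMDiff_coord.comp contMDiff_snd)
  contMDiff_inv := by
    refine s.contMDiff_of_coord s.continuous_inv' ?_
    have h₁ : (s.coord ∘ fun g : s.Space => g⁻¹) = fun g => -s.coord g :=
      funext fun g => s.coord_inv _
    rw [h₁]
    exact s.contMDiff_coord.neg

/-- The adjoint representation is trivial, as conjugation by `g` is the identity near `1`. -/
theorem ad_eq_one (g : s.Space) : Ad 𝓘(𝕜) s.Space g = 1 := by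
  have h : (fun x : s.Space => g * x * g⁻¹) =ᶠ[𝓝 1] id := by
    filter_upwards [s.eventually_eq_mul_lift 1, s.eventually_commute_lift g 1] with y hy hc
    rw [one_mul] at hy
    rw [← hy] at hc
    rw [hc.eq, mul_inv_cancel_right, id]
  apply Units.ext
  apply LinearMap.ext
  intro v
  change mfderiv 𝓘(𝕜) 𝓘(𝕜) (fun x : s.Space => g * x * g⁻¹) 1 v = v
  rw [h.mfderiv_eq, mfderiv_id]
  rfl

theorem ker_ad_eq_top : (Ad 𝓘(𝕜) s.Space).ker = ⊤ :=
  (Subgroup.eq_top_iff' _).2 s.ad_eq_one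

theorem isLocalDiffeomorph_coord : IsLocalDiffeomorph 𝓘(𝕜) 𝓘(𝕜) ω s.coord := fun g =>
  ⟨{ toPartialEquiv := (s.chart g).toPartialEquiv
     open_source := (s.chart g).open_source
     open_target := (s.chart g).open_target
     contMDiffOn_toFun := s.contMDiff_coord.contMDiffOn
     contMDiffOn_invFun := by
      refine ContMDiff.contMDiffOn (s.contMDiff_of_coord ?_ ?_)
      · exact continuousOn_univ.1 (s.chart g).continuousOn_invFun
      · have h₁ : s.coord ∘ (s.chart g).invFun = id :=
          funext fun x => (s.chart g).right_inv' (Set.mem_univ x)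
        exact h₁ ▸ contMDiff_id }, rfl, fun _ _ => rfl⟩

/-- The retraction as a homomorphism on `s.Space`. -/
def projHom : s.Space →* Multiplicative 𝕜 := s.proj

/-- The kernel of the retraction is discrete, and so is each of its subgroups. -/
theorem discreteTopology_of_le_ker {L : Subgroup s.Space} (hL : L ≤ s.projHom.ker) :
    DiscreteTopology L := by
  have hk (x : L) : s.kerPart x = x := s.kerPart_eq_self (hL x.2)
  refine discreteTopology_iff_isOpen_singleton.2 fun x => ?_
  convert (s.isOpen_kerPart_eq x).preimage continuous_subtype_val
  ext y
  simp only [Set.mem_singleton_iff, Set.mem_preimage, Set.mem_ofPred_eq, hk, Subtype.ext_iff]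

/-- The isomorphism of topological groups induced by the retraction; its inverse is induced by the
section. -/
noncomputable def quotientKerEquiv : s.Space ⧸ s.projHom.ker ≃ₜ* Multiplicative 𝕜 where
  toMulEquiv := QuotientGroup.quotientKerEquivOfRightInverse s.projHom s.sec s.proj_sec
  continuous_toFun := by
    exact (QuotientGroup.isQuotientMap_mk s.projHom.ker).continuous_iff.2 s.continuous_coord
  continuous_invFun := by
    exact QuotientGroup.continuous_mk.comp s.continuous_lift

/-- The retraction, followed by the embedding of `𝕜` as the group of unitriangular matrices. -/
def unitriangularHom : s.Space →* Matrix.GeneralLinearGroup (Fin 2) 𝕜 :=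
  (unitriangular 𝕜).comp s.projHom

theorem contMDiff_unitriangularHom (i j : Fin 2) : ContMDiff 𝓘(𝕜) 𝓘(𝕜) ω
    (fun g : s.Space => (s.unitriangularHom g : Matrix (Fin 2) (Fin 2) 𝕜) i j) := by
  fin_cases i <;> fin_cases j
  · exact contMDiff_const
  · exact s.contMDiff_coord
  · exact contMDiff_const
  · exact contMDiff_const

theorem ker_unitriangularHom : s.unitriangularHom.ker = s.projHom.ker :=
  MonoidHom.ker_comp_of_injective _ _ (unitriangular_injective _)

theorem commutator_le_ker : commutator s.Space ≤ s.projHom.ker :=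
  Abelianization.commutator_subset_ker _

/-- The trivial subgroup is not open, as the field `𝕜` is not discrete. -/
theorem not_isOpen_singleton_one : ¬ IsOpen ({1} : Set s.Space) := by
  intro h
  have h₁ := h.preimage s.continuous_lift
  have h₂ : s.lift ⁻¹' {1} = {0} := by
    ext x
    refine ⟨fun hx => ?_, fun hx => ?_⟩
    · have := congrArg s.coord (Set.mem_singleton_iff.1 hx)
      simpa using this
    · simp [Set.mem_singleton_iff.1 hx]
  rw [h₂] at h₁
  exact not_isOpen_singleton (0 : 𝕜) h₁

/-- If `Γ` has no nontrivial abelian subnormal subgroup, then the kernel of the adjoint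
representation, which is the whole group, has no abelian open normal subgroup, as such a subgroup
would be trivial, and the trivial subgroup is not open. -/
theorem not_exists_isOpen_normal_abelian
    (hs : ∀ S : Subgroup s.Space, S.IsSubnormal → (∀ x ∈ S, ∀ y ∈ S, x * y = y * x) → S = ⊥) :
    ¬ ∃ U : Subgroup (Ad 𝓘(𝕜) s.Space).ker, U.Normal ∧
      IsOpen (U : Set (Ad 𝓘(𝕜) s.Space).ker) ∧ ∀ x ∈ U, ∀ y ∈ U, x * y = y * x := by
  rintro ⟨U, hU, hUo, hUc⟩
  have hbot : U.map (Ad 𝓘(𝕜) s.Space).ker.subtype = ⊥ := by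
    refine hs _ (.step _ _ (Subgroup.map_subtype_le U)
      (Subgroup.Normal.isSubnormal inferInstance) ?_) ?_
    · rwa [Subgroup.subgroupOf,
        Subgroup.comap_map_eq_self_of_injective (Subgroup.subtype_injective _)]
    · rintro _ ⟨x, hx, rfl⟩ _ ⟨y, hy, rfl⟩
      exact congrArg Subtype.val (hUc x hx y hy)
  have hker : IsOpen ((Ad 𝓘(𝕜) s.Space).ker : Set s.Space) := by
    rw [ker_ad_eq_top]
    exact isOpen_univ
  apply s.not_isOpen_singleton_one
  rw [← Subgroup.coe_bot, ← hbot, Subgroup.coe_map]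
  exact hker.isOpenMap_subtype_val _ hUo

end LocallyCentralSplitting

end LocallyCentral

/-! ### The group `G` -/

section Conclusion

variable (p : ℕ) [Fact p.Prime]

/-- The splitting of `G` given by the first factor `ℚ_p` and the retraction onto it. -/
noncomputable def splittingG : LocallyCentralSplitting ℚ_[p] (G p) where
  proj := projG p
  sec := (toG p 0).comp (stage p 0).incl
  proj_sec _ := rfl
  eventually_commute g := by
    obtain ⟨n, a, rfl⟩ := exists_toG p g
    filter_upwards [eventually_mem_powSubgroup p n] with x hx
    have h : toG p 0 ((stage p 0).incl (.ofAdd x)) = toG p n ((stage p n).incl (.ofAdd x)) := by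
      rw [← trans_incl p 0 n n.zero_le, toG_trans]
    rw [MonoidHom.comp_apply, h]
    exact (commute_incl_of_mem p n a _ hx).map (toG p n)

end Conclusion

end AmalgamLie

theorem mainTheorem1 (p : ℕ) [Fact p.Prime] :
    ∃ (_ : TopologicalSpace (AmalgamLie.G p)) (_ : ChartedSpace ℚ_[p] (AmalgamLie.G p))
      (_ : LieGroup 𝓘(ℚ_[p]) ω (AmalgamLie.G p)),
      T2Space (AmalgamLie.G p) ∧
      -- (a)
      ((∀ g : AmalgamLie.G p, AmalgamLie.Ad 𝓘(ℚ_[p]) (AmalgamLie.G p) g = 1) ∧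
        (AmalgamLie.Ad 𝓘(ℚ_[p]) (AmalgamLie.G p)).ker = ⊤) ∧
      -- (b)
      (∀ S : Subgroup (AmalgamLie.G p), S.IsSubnormal →
        (∀ x ∈ S, ∀ y ∈ S, x * y = y * x) → S = ⊥) ∧
      -- (c)
      (∃ (K : Subgroup (AmalgamLie.G p)) (_ : K.Normal),
        DiscreteTopology K ∧
        (∃ e : (AmalgamLie.G p ⧸ K) ≃ₜ* Multiplicative ℚ_[p],
          IsLocalDiffeomorph 𝓘(ℚ_[p]) 𝓘(ℚ_[p]) ω
            (fun g : AmalgamLie.G p => (e (g : AmalgamLie.G p ⧸ K)).toAdd)) ∧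
        -- a map into the open subset `GL₂(ℚ_p)` of `ℚ_p^(2 × 2)` is analytic iff its entries are
        ∃ ψ : AmalgamLie.G p →* Matrix.GeneralLinearGroup (Fin 2) ℚ_[p],
          (∀ i j : Fin 2, ContMDiff 𝓘(ℚ_[p]) 𝓘(ℚ_[p]) ω
            (fun g : AmalgamLie.G p => (ψ g : Matrix (Fin 2) (Fin 2) ℚ_[p]) i j)) ∧
          K = ψ.ker) ∧
      -- (d)
      DiscreteTopology (commutator (AmalgamLie.G p)) ∧
      -- consequently, `ker Ad` has no abelian open normal subgroup
      ¬ ∃ U : Subgroup (AmalgamLie.Ad 𝓘(ℚ_[p]) (AmalgamLie.G p)).ker,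
        U.Normal ∧ IsOpen (U : Set (AmalgamLie.Ad 𝓘(ℚ_[p]) (AmalgamLie.G p)).ker) ∧
          ∀ x ∈ U, ∀ y ∈ U, x * y = y * x := by
  let s := AmalgamLie.splittingG p
  have hb : ∀ S : Subgroup s.Space, S.IsSubnormal →
      (∀ x ∈ S, ∀ y ∈ S, x * y = y * x) → S = ⊥ := fun S =>
    AmalgamLie.eq_bot_of_isSubnormal_of_commute (AmalgamLie.exists_iterate_commutator_ne_one p)
  exact ⟨s.instTopologicalSpace, s.instChartedSpace, s.instLieGroup, s.instT2Space,
    ⟨s.ad_eq_one, s.ker_ad_eq_top⟩, hb,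
    ⟨s.projHom.ker, MonoidHom.normal_ker _, s.discreteTopology_of_le_ker le_rfl,
      ⟨s.quotientKerEquiv, s.isLocalDiffeomorph_coord⟩,
      s.unitriangularHom, s.contMDiff_unitriangularHom, s.ker_unitriangularHom.symm⟩,
    s.discreteTopology_of_le_ker s.commutator_le_ker,
    s.not_exists_isOpen_normal_abelian hb⟩
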